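/- All graphs are mixed graphs on one finite vertex set $V$: they have directed edges $X\to Y$ and bi-directed edges $X\leftrightarrow Y$ (with $X\neq Y$), and both kinds may join the same two vertices. d-separation is defined through paths (without repeated vertices): a path is open given $C$ if every collider on it is an ancestor of a member of $C$ and no other interior vertex is in $C$ (every vertex is an ancestor of itself). Two graphs are Markov equivalent if they entail the same d-separations. * A MAG is a mixed graph without directed cycles and without almost directed cycles (a directed path from $X$ to $Y$ together with $X\leftrightarrow Y$), in which any two distinct non-adjacent vertices are d-separated by some set. A loyal equivalent graph (LEG) of a MAG $M$ is a MAG $L$, Markov equivalent to $M$, that has every directed edge of $M$ and each of whose bi-directed edges occurs in every MAG Markov equivalent to $L$. An LEG is an LEG of some MAG. * A causal diagram is a mixed graph without directed cycles. It is *compatible* with an LEG $L$ if it has the same d-separations and the same ancestral relations as $L$ and has every directed edge of $L$. * A causal diagram is *maximally bi-directed* (MBD) if no further bi-directed edge can be added to it without breaking a d-separation. * Let $G$ be a mixed graph with the directed edges of $L$ and possibly more bi-directed edges than $L$. A directed edge $X\to Y$ of $G$ without $X\leftrightarrow Y$ in $G$ is *invisible* in $G$ if some causal diagram compatible with $L$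 contains all edges of $G$ and the edge $X\leftrightarrow Y$. **Procedure** (input: an LEG $L$). For every invisible edge $X\to Y$ of $L$ such that $X$ has no parent or spouse (other than $Y$) that is not adjacent to $Y$, create the diagram obtained from $L$ by adding $X\leftrightarrow Y$; if $L$ has no invisible edge, take $L$ itself as the only diagram. Put those of these diagrams that have invisible edges in a list $S$ and the others in a list $S'$. While $S$ is not empty, do for every $G$ in $S$: create the diagrams $G_1,\dots,G_k$, each obtained from $G$ by adding a bi-directed edge over one of the $k$ invisible edges of $G$; append those without invisible edges to $S'$, append those with invisible edges to $S$, and remove $G$ from $S$. Return $S'$. **Proposition.** For every LEG $L$ on a finite vertex set the procedure terminates, and the diagrams in the list it returns are exactly the maximally bi-directed causal diagrams compatible with $L$. -/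

import Mathlib

/-- A mixed graph on the vertex set `V`: directed edges `X → Y` (`dir X Y`) and bi-directed edges
`X ↔ Y` (`bi X Y`). Both kinds of edges may be present between the same two vertices. -/
@[ext]
structure MixedGraph (V : Type*) where
  dir : V → V → Prop
  bi : V → V → Prop
  bi_symm : ∀ X Y, bi X Y → bi Y X
  bi_irrefl : ∀ X, ¬ bi X X

/-- The ways in which an edge can be traversed from `u` to `v`:
`fwd` is `u → v`, `bwd` is `u ← v`, `bidir` is `u ↔ v`. -/
inductive EdgeKind where
  | fwd
  | bwd
  | bidir

namespace EdgeKind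

/-- The edge has an arrowhead at the vertex where its traversal starts. -/
def HeadAtSource : EdgeKind → Prop
  | fwd => False
  | bwd => True
  | bidir => True

/-- The edge has an arrowhead at the vertex where its traversal ends. -/
def HeadAtTarget : EdgeKind → Prop
  | fwd => True
  | bwd => False
  | bidir => True

end EdgeKind

namespace MixedGraph

variable {V : Type*}

def HasEdge (G : MixedGraph V) : EdgeKind → V → V → Prop
  | .fwd, u, v => G.dir u v
  | .bwd, u, v => G.dir v u
  | .bidir, u, v => G.bi u v

def Adjacent (G : MixedGraph V) (X Y : V) : Prop :=
  G.dir X Y ∨ G.dir Y X ∨ G.bi X Y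

/-- `X` is an ancestor of `Y`; every vertex is an ancestor of itself. -/
def IsAncestor (G : MixedGraph V) (X Y : V) : Prop :=
  Relation.ReflTransGen G.dir X Y

/-- No directed cycle. -/
def DirAcyclic (G : MixedGraph V) : Prop :=
  ∀ X, ¬ Relation.TransGen G.dir X X

/-- Edge-wise inclusion: every edge of `G` is an edge of `H`. -/
def Contains (H G : MixedGraph V) : Prop :=
  (∀ X Y, G.dir X Y → H.dir X Y) ∧ (∀ X Y, G.bi X Y → H.bi X Y)

/-- The graph `G` with the bi-directed edge `X ↔ Y` added. -/
def addBi (G : MixedGraph V) (X Y : V) : MixedGraph V where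
  dir := G.dir
  bi u v := G.bi u v ∨ (u ≠ v ∧ s(u, v) = s(X, Y))
  bi_symm u v h := by
    rcases h with h | ⟨hne, h⟩
    · exact Or.inl (G.bi_symm u v h)
    · exact Or.inr ⟨hne.symm, by rw [Sym2.eq_swap]; exact h⟩
  bi_irrefl u h := by
    rcases h with h | ⟨hne, _⟩
    · exact G.bi_irrefl u h
    · exact hne rfl

/-! ### d-separation -/

/-- Edge sequences in a mixed graph. -/
inductive Walk (G : MixedGraph V) : V → V → Type _ where
  | nil (u : V) : Walk G u u
  | cons {u v w : V} (k : EdgeKind) (h : G.HasEdge k u v) (p : Walk G v w) : Walk G u w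

namespace Walk

variable {G : MixedGraph V}

def support : {u v : V} → Walk G u v → List V
  | _, _, nil u => [u]
  | u, _, cons _ _ p => u :: p.support

/-- The passage through the vertex `v` along an edge of kind `k` (arriving) and an edge of
kind `k'` (leaving) is open given `C`: a collider has to be an ancestor of a member of `C`,
a non-collider has to be outside `C`. -/
def OpenAt (G : MixedGraph V) (C : Set V) (k : EdgeKind) (v : V) (k' : EdgeKind) : Prop :=
  (k.HeadAtTarget ∧ k'.HeadAtSource → ∃ c ∈ C, G.IsAncestor v c) ∧
    (¬ (k.HeadAtTarget ∧ k'.HeadAtSource) → v ∉ C)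

/-- All the passages along the walk are open, when its first vertex is reached
through an edge of kind `k`. -/
def OpenAfter (C : Set V) : {u v : V} → EdgeKind → Walk G u v → Prop
  | _, _, _, nil _ => True
  | u, _, k, cons k' _ p => OpenAt G C k u k' ∧ OpenAfter C k' p

/-- All the passages through interior vertices of the walk are open given `C`. -/
def IsOpen (C : Set V) : {u v : V} → Walk G u v → Prop
  | _, _, nil _ => True
  | _, _, cons k _ p => OpenAfter C k p

end Walk

/-- There is a path (no repeated vertices) between `a` and `b` that is open given `C`. -/
def DConnected (G : MixedGraph V) (C : Set V) (a b : V) : Prop :=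
  ∃ p : Walk G a b, p.support.Nodup ∧ p.IsOpen C

/-- `A` and `B` are d-separated by `C`; for MAGs this is called m-separation. -/
def DSep (G : MixedGraph V) (A B C : Set V) : Prop :=
  ∀ a ∈ A, ∀ b ∈ B, ¬ G.DConnected C a b

/-- The two graphs entail the same d-separations. -/
def MarkovEquiv (G H : MixedGraph V) : Prop :=
  ∀ A B C : Set V, Disjoint A B → Disjoint A C → Disjoint B C → (G.DSep A B C ↔ H.DSep A B C)

/-! ### Maximal ancestral graphs and loyal equivalent graphs -/

/-- No directed cycle, and no almost directed cycle. -/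
def IsAncestral (G : MixedGraph V) : Prop :=
  G.DirAcyclic ∧ ∀ X Y, G.bi X Y → ¬ G.IsAncestor X Y

/-- Any two distinct non-adjacent vertices are d-separated by some set. -/
def IsMaximal (G : MixedGraph V) : Prop :=
  ∀ X Y, X ≠ Y → ¬ G.Adjacent X Y → ∃ Z : Set V, X ∉ Z ∧ Y ∉ Z ∧ G.DSep {X} {Y} Z

def IsMAG (G : MixedGraph V) : Prop :=
  G.IsAncestral ∧ G.IsMaximal

/-- `L` is a loyal equivalent graph of the MAG `G`: a Markov equivalent MAG whose bi-directed
edges are all invariant (present in every Markov equivalent MAG) and which has all the directed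
edges of `G`. -/
def IsLEGOf (L G : MixedGraph V) : Prop :=
  L.IsMAG ∧ L.MarkovEquiv G ∧
    (∀ X Y, L.bi X Y → ∀ H : MixedGraph V, H.IsMAG → H.MarkovEquiv L → H.bi X Y) ∧
    (∀ X Y, G.dir X Y → L.dir X Y)

def IsLEG (L : MixedGraph V) : Prop :=
  ∃ G : MixedGraph V, G.IsMAG ∧ L.IsLEGOf G

/-! ### Causal diagrams -/

/-- A causal diagram (of a recursive structural causal model): bi-directed edges stand for
unobserved confounders, and there is no directed cycle. -/
def IsCausalDiagram (G : MixedGraph V) : Prop :=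
  G.DirAcyclic

/-- The causal diagram `G` is represented by the MAG `L`:
same d-separations, same ancestral relations. -/
def IsRepresentedBy (G L : MixedGraph V) : Prop :=
  G.IsCausalDiagram ∧ G.MarkovEquiv L ∧ ∀ X Y, G.IsAncestor X Y ↔ L.IsAncestor X Y

/-- The causal diagram `G` is represented by `L` and has all the directed edges of `L`. -/
def IsCompatibleWith (G L : MixedGraph V) : Prop :=
  G.IsRepresentedBy L ∧ ∀ X Y, L.dir X Y → G.dir X Y

/-- Maximally bi-directed: adding any further bi-directed edge breaks a d-separation. -/
def IsMBD (G : MixedGraph V) : Prop :=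
  ∀ X Y, X ≠ Y → ¬ G.bi X Y → ¬ (G.addBi X Y).MarkovEquiv G

/-! ### The branching procedure -/

/-- The directed edge `X → Y` of `G` (a diagram built on the graph `L`) is invisible: `G` does not
have `X ↔ Y` yet, and unobserved confounding between `X` and `Y` cannot be ruled out, that is, some
causal diagram compatible with `L` has all the edges of `G` and also `X ↔ Y`. -/
def IsInvisible (L G : MixedGraph V) (X Y : V) : Prop :=
  G.dir X Y ∧ ¬ G.bi X Y ∧ ∃ H : MixedGraph V, H.IsCompatibleWith L ∧ H.Contains G ∧ H.bi X Y

def HasInvisible (L G : MixedGraph V) : Prop :=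
  ∃ X Y, IsInvisible L G X Y

/-- Every parent or spouse of `X` (other than `Y`) is adjacent to `Y`. -/
def ParentsSpousesAdjacent (G : MixedGraph V) (X Y : V) : Prop :=
  ∀ Z, Z ≠ Y → (G.dir Z X ∨ G.bi Z X) → G.Adjacent Z Y

section Algorithm

variable [Fintype V]

/-- A list of the invisible edges of `G`. -/
noncomputable def invisibleEdges (L G : MixedGraph V) : List (V × V) :=
  open Classical in
  (Finset.univ.filter fun e : V × V => IsInvisible L G e.1 e.2).toList

/-- The diagrams `G₁, …, G_k` obtained from `G` by adding a bi-directed edge over one of its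
`k` invisible edges. -/
noncomputable def children (L G : MixedGraph V) : List (MixedGraph V) :=
  (invisibleEdges L G).map fun e => G.addBi e.1 e.2

/-- The diagrams of a list in which invisible edges exist. -/
noncomputable def unfinished (L : MixedGraph V) (l : List (MixedGraph V)) : List (MixedGraph V) :=
  open Classical in
  l.filter fun G => decide (HasInvisible L G)

/-- The diagrams of a list in which invisible edges do not exist. -/
noncomputable def finished (L : MixedGraph V) (l : List (MixedGraph V)) : List (MixedGraph V) :=
  open Classical in
  l.filter fun G => decide (¬ HasInvisible L G)

/-- The diagrams from which the procedure starts: one for every invisible edge `X → Y` of `L` such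
that `X` has no parent or spouse that is not adjacent to `Y`, obtained by adding `X ↔ Y` to `L`;
if `L` has no invisible edge at all, then `L` itself. -/
noncomputable def initialDiagrams (L : MixedGraph V) : List (MixedGraph V) :=
  open Classical in
  if HasInvisible L L then
    ((invisibleEdges L L).filter fun e => decide (L.ParentsSpousesAdjacent e.1 e.2)).map
      fun e => L.addBi e.1 e.2
  else [L]

/-- The initial state `(S, S')` of the procedure: `S` is the list of diagrams that still have to be
processed, `S'` is the list of diagrams to be returned. -/
noncomputable def initialState (L : MixedGraph V) : List (MixedGraph V) × List (MixedGraph V) :=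
  (unfinished L (initialDiagrams L), finished L (initialDiagrams L))

/-- One pass of the while loop: every diagram in `S` is replaced by those of its children which have
invisible edges; the children without invisible edges are appended to `S'`. -/
noncomputable def pass (L : MixedGraph V) (s : List (MixedGraph V) × List (MixedGraph V)) :
    List (MixedGraph V) × List (MixedGraph V) :=
  (s.1.flatMap fun G => unfinished L (children L G),
    s.2 ++ s.1.flatMap fun G => finished L (children L G))

/-- The procedure terminates on the input `L` (the list `S` becomes empty after finitely many
passes) and returns the list `out`. -/
def Returns (L : MixedGraph V) (out : List (MixedGraph V)) : Prop :=
  ∃ n : ℕ, (pass L)^[n] (initialState L) = ([], out)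

end Algorithm

end MixedGraph

/-! The engine is monotonicity: with the directed edges fixed, extra bi-directed edges can only
destroy d-separations. A diagram `H` compatible with `L` has exactly the directed edges of `L`
(`IsCompatibleWith.dir_eq`), so everything lying between `L` and `H` is compatible as well
(`IsCompatibleWith.of_contains`). Hence any compatible diagram above `L` is reached by adding its
bi-directed edges one at a time. Each new one joins vertices that are adjacent in `L`, so it lies
over an invisible edge; among diagrams containing `L`, being MBD therefore means having no invisible
edge (`IsCompatibleWith.isMBD_iff`).

Two points remain. An MBD diagram must contain the bi-directed edges of `L`: each of them yields an
inducing chain in the diagram, and an edge over such a chain can be added for free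
(`IsCompatibleWith.contains_of_isMBD`). And the test on parents and spouses in the starting step
discards nothing, since every invisible edge of `L` passes it.

d-connection is handled through open walks; loops can be cut out because colliders need only be
ancestors of `C`. -/

namespace MixedGraph

variable {V : Type*}

/-! ### Open trails -/

/-- `G.Trail C k u v l`: there is a nonempty walk from `u` to `v`, with first edge of kind `k` and
last edge of kind `l`, all of whose passages are open given `C`. -/
inductive Trail (G : MixedGraph V) (C : Set V) : EdgeKind → V → V → EdgeKind → Prop
  | single {k : EdgeKind} {u v : V} (h : G.HasEdge k u v) : Trail G C k u v k
  | cons {k k' l : EdgeKind} {u v w : V} (h : G.HasEdge k u v) (ho : Walk.OpenAt G C k v k')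
      (t : Trail G C k' v w l) : Trail G C k u w l

variable {G H L : MixedGraph V} {C : Set V}

theorem Walk.OpenAt.congr {k l k' l' : EdgeKind} {v : V} (h : Walk.OpenAt G C k v l)
    (hk : k'.HeadAtTarget ↔ k.HeadAtTarget) (hl : l'.HeadAtSource ↔ l.HeadAtSource)
    (hd : G.dir = H.dir) : Walk.OpenAt H C k' v l' := by
  unfold Walk.OpenAt IsAncestor at *
  rw [hk, hl, ← hd]
  exact h

theorem Trail.append {k k₁ k₂ l : EdgeKind} {u v w : V} (s : G.Trail C k u v k₁)
    (ho : Walk.OpenAt G C k₁ v k₂) (t : G.Trail C k₂ v w l) : G.Trail C k u w l := by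
  induction s with
  | single h => exact .cons h ho t
  | cons h ho' _ ih => exact .cons h ho' (ih ho t)

theorem Trail.exists_walk {k l : EdgeKind} {u w : V} (t : G.Trail C k u w l) :
    ∃ (v : V) (_ : G.HasEdge k u v) (p : Walk G v w), p.OpenAfter C k := by
  induction t with
  | single h => exact ⟨_, h, .nil _, trivial⟩
  | cons h ho _ ih =>
    obtain ⟨v', h', p, hp⟩ := ih
    exact ⟨_, h, .cons _ h' p, ho, hp⟩

theorem Walk.OpenAfter.exists_trail {u v w : V} {k : EdgeKind} (h : G.HasEdge k u v)
    {p : Walk G v w} (hp : p.OpenAfter C k) : ∃ l, G.Trail C k u w l := by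
  induction p generalizing u k with
  | nil v => exact ⟨k, .single h⟩
  | cons k' h' p ih =>
    obtain ⟨l, t⟩ := ih h' hp.2
    exact ⟨l, .cons h hp.1 t⟩

/-- A suffix of an open walk that starts at a given vertex of the walk. -/
theorem Walk.OpenAfter.exists_suffix {u v w : V} {k : EdgeKind} {p : Walk G u w}
    (hp : p.OpenAfter C k) (hv : v ∈ p.support) :
    ∃ (q : Walk G v w) (j : EdgeKind), q.OpenAfter C j ∧ q.support.Sublist p.support ∧
      (k.HeadAtTarget → (∃ c ∈ C, G.IsAncestor u c) ∨ j.HeadAtTarget ∧ G.IsAncestor u v) := by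
  induction p generalizing k with
  | nil u =>
    obtain rfl : v = u := by simpa [Walk.support] using hv
    exact ⟨.nil v, k, trivial, List.Sublist.refl _, fun h => .inr ⟨h, .refl⟩⟩
  | @cons u x w k' h p ih =>
    by_cases huv : v = u
    · subst huv
      exact ⟨.cons k' h p, k, hp, List.Sublist.refl _, fun h => .inr ⟨h, .refl⟩⟩
    have hv' : v ∈ p.support := by simpa [Walk.support, huv] using hv
    obtain ⟨q, j, hq, hs, hj⟩ := ih hp.2 hv'
    refine ⟨q, j, hq, hs.trans (List.sublist_cons_self _ _), fun hk => ?_⟩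
    -- Entering `u` with an arrowhead, the walk follows directed edges up to its first collider,
    -- which is an ancestor of `C`, unless `v` comes first.
    cases k' with
    | fwd =>
      have hux : G.IsAncestor u x := .single h
      rcases hj trivial with ⟨c, hc, ha⟩ | ⟨h1, h2⟩
      · exact .inl ⟨c, hc, hux.trans ha⟩
      · exact .inr ⟨h1, hux.trans h2⟩
    | bwd => exact .inl (hp.1.1 ⟨hk, trivial⟩)
    | bidir => exact .inl (hp.1.1 ⟨hk, trivial⟩)

/-- A loop at `u` can be cut out. If the cut makes `u` a new collider, then the old walk left `u` by
a tail, and following it forward leads to a member of `C` or back to `u` with an arrowhead, where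
`u` was already an open collider. -/
theorem Walk.OpenAfter.exists_path {u w : V} {k : EdgeKind} {p : Walk G u w}
    (hp : p.OpenAfter C k) : ∃ q : Walk G u w, q.support.Nodup ∧ q.OpenAfter C k := by
  induction p generalizing k with
  | nil u => exact ⟨.nil u, by simp [Walk.support], trivial⟩
  | @cons u x w k' h p ih =>
    obtain ⟨q, hnd, hq⟩ := ih hp.2
    by_cases hu : u ∈ q.support
    · obtain ⟨r, j, hr, hs, hj⟩ := hq.exists_suffix hu
      refine ⟨r, hnd.sublist hs, ?_⟩
      cases r with
      | nil => trivial
      | cons k'' h'' r =>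
        refine ⟨⟨fun hc => ?_, fun hn hC => ?_⟩, hr.2⟩
        · by_cases hk' : k'.HeadAtSource
          · exact hp.1.1 ⟨hc.1, hk'⟩
          · cases k' with
            | fwd =>
              rcases hj trivial with ⟨c, hc', ha⟩ | ⟨h1, _⟩
              · exact ⟨c, hc', .head h ha⟩
              · exact hr.1.1 ⟨h1, hc.2⟩
            | bwd => exact absurd trivial hk'
            | bidir => exact absurd trivial hk'
        -- A non-collider after the cut has a tail at `u`, and the edge with that tail made `u` a
        -- non-collider on one of the two old passages.
        · by_cases hk : k.HeadAtTarget
          · exact hr.1.2 (fun h => hn ⟨hk, h.2⟩) hC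
          · exact hp.1.2 (fun h => hk h.1) hC
    · exact ⟨.cons k' h q, List.nodup_cons.2 ⟨hu, hnd⟩, hp.1, hq⟩

theorem Trail.dConnected {k l : EdgeKind} {u w : V} (t : G.Trail C k u w l) :
    G.DConnected C u w := by
  obtain ⟨v, h, p, hp⟩ := t.exists_walk
  obtain ⟨q, hnd, hq⟩ := hp.exists_path
  by_cases hu : u ∈ q.support
  · obtain ⟨r, j, hr, hs, _⟩ := hq.exists_suffix hu
    refine ⟨r, hnd.sublist hs, ?_⟩
    cases r with
    | nil => trivial
    | cons => exact hr.2
  · exact ⟨.cons k h q, List.nodup_cons.2 ⟨hu, hnd⟩, hq⟩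

theorem dConnected_iff_exists_trail {a b : V} (hab : a ≠ b) :
    G.DConnected C a b ↔ ∃ k l, G.Trail C k a b l := by
  refine ⟨?_, fun ⟨_, _, t⟩ => t.dConnected⟩
  rintro ⟨p, -, hp⟩
  cases p with
  | nil => exact absurd rfl hab
  | cons k h p => exact ⟨k, Walk.OpenAfter.exists_trail h hp⟩

/-- Openness of a passage depends only on the arrowheads at its vertex and on ancestry, so edges can
be replaced by open trails with the same arrowheads at both ends. -/
theorem Trail.map (hd : G.dir = H.dir)
    (hE : ∀ k u v, G.HasEdge k u v → ∃ k' l', H.Trail C k' u v l' ∧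
      (k'.HeadAtSource ↔ k.HeadAtSource) ∧ (l'.HeadAtTarget ↔ k.HeadAtTarget))
    {k l : EdgeKind} {u v : V} (t : G.Trail C k u v l) :
    ∃ k' l', H.Trail C k' u v l' ∧ (k'.HeadAtSource ↔ k.HeadAtSource) := by
  induction t with
  | single h =>
    obtain ⟨k', l', t, h1, _⟩ := hE _ _ _ h
    exact ⟨k', l', t, h1⟩
  | cons h ho _ ih =>
    obtain ⟨k', l', t, h1, h2⟩ := hE _ _ _ h
    obtain ⟨k'', l'', t', h3⟩ := ih
    exact ⟨k', l'', t.append (ho.congr h2 h3 hd) t', h1⟩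

theorem DConnected.map (hd : G.dir = H.dir)
    (hE : ∀ k u v, G.HasEdge k u v → ∃ k' l', H.Trail C k' u v l' ∧
      (k'.HeadAtSource ↔ k.HeadAtSource) ∧ (l'.HeadAtTarget ↔ k.HeadAtTarget))
    {a b : V} (hab : a ≠ b) (h : G.DConnected C a b) : H.DConnected C a b := by
  obtain ⟨k, l, t⟩ := (dConnected_iff_exists_trail hab).1 h
  obtain ⟨k', l', t', _⟩ := t.map hd hE
  exact t'.dConnected

/-- With the same directed edges, more bi-directed edges give more d-connections. -/
theorem DConnected.mono (hd : G.dir = H.dir) (hb : ∀ X Y, G.bi X Y → H.bi X Y)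
    {a b : V} (hab : a ≠ b) (h : G.DConnected C a b) : H.DConnected C a b := by
  refine h.map hd (fun k u v e => ⟨k, k, .single ?_, Iff.rfl, Iff.rfl⟩) hab
  cases k with
  | fwd => exact (congrFun₂ hd u v).mp e
  | bwd => exact (congrFun₂ hd v u).mp e
  | bidir => exact hb _ _ e

theorem DSep.anti (hd : G.dir = H.dir) (hb : ∀ X Y, G.bi X Y → H.bi X Y) {A B : Set V}
    (hAB : Disjoint A B) (h : H.DSep A B C) : G.DSep A B C := fun a ha b hb' hc =>
  h a ha b hb' (hc.mono hd hb (fun e => Set.disjoint_left.1 hAB ha (e ▸ hb')))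

/-! ### Inducing chains -/

/-- A directed path that avoids `C` is an open trail. -/
theorem IsAncestor.trail {u v : V} (h : G.IsAncestor u v) (huv : u ≠ v)
    (hC : ¬ ∃ c ∈ C, G.IsAncestor u c) : G.Trail C .fwd u v .fwd := by
  induction h using Relation.ReflTransGen.head_induction_on with
  | refl => exact absurd rfl huv
  | @head a c e h ih =>
    by_cases hcv : c = v
    · subst hcv
      exact .single e
    · have hC' : ¬ ∃ x ∈ C, G.IsAncestor c x := fun ⟨x, hx, hcx⟩ => hC ⟨x, hx, .head e hcx⟩
      exact .cons (k' := .fwd) e ⟨fun h => False.elim h.2, fun _ hc => hC' ⟨c, hc, .refl⟩⟩ (ih hcv hC')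

theorem IsAncestor.trail_bwd {u v : V} (h : G.IsAncestor u v) (huv : u ≠ v)
    (hC : ¬ ∃ c ∈ C, G.IsAncestor u c) : G.Trail C .bwd v u .bwd := by
  induction h using Relation.ReflTransGen.head_induction_on with
  | refl => exact absurd rfl huv
  | @head a c e h ih =>
    by_cases hcv : c = v
    · subst hcv
      exact .single e
    · have hC' : ¬ ∃ x ∈ C, G.IsAncestor c x := fun ⟨x, hx, hcx⟩ => hC ⟨x, hx, .head e hcx⟩
      exact (ih hcv hC').append ⟨fun h => False.elim h.1, fun _ hc => hC' ⟨c, hc, .refl⟩⟩ (.single e)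

/-- A step along a bi-directed edge to an ancestor of `X` or `Y`. -/
def InducingStep (G : MixedGraph V) (X Y u v : V) : Prop :=
  G.bi u v ∧ (G.IsAncestor v X ∨ G.IsAncestor v Y)

/-- Moving along the chain, a vertex with a descendant in `C` is passed as a collider. From any
other vertex a directed path to `X` or `Y` avoids `C`: one to `X`, reversed, replaces the trail
built so far; one to `Y` completes it. -/
theorem exists_trail_of_inducing_prefix {X Y v : V}
    (h : Relation.ReflTransGen (G.InducingStep X Y) X v) (C : Set V) :
    (v = X ∨ ∃ k l, G.Trail C k X v l ∧ k.HeadAtSource ∧ Walk.OpenAt G C l v .bidir) ∨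
      ∃ k l, G.Trail C k X Y l ∧ k.HeadAtSource ∧ l.HeadAtTarget := by
  induction h with
  | refl => exact .inl (.inl rfl)
  | @tail b c _ hbc ih =>
    rcases ih with ih | ih
    · have ht : ∃ k, G.Trail C k X c .bidir ∧ k.HeadAtSource := by
        rcases ih with rfl | ⟨k, l, t, hk, ho⟩
        · exact ⟨_, .single hbc.1, trivial⟩
        · exact ⟨k, t.append ho (.single hbc.1), hk⟩
      obtain ⟨k, t, hk⟩ := ht
      by_cases hc : ∃ x ∈ C, G.IsAncestor c x
      · exact .inl (.inr ⟨k, _, t, hk, fun _ => hc, fun hn => absurd ⟨trivial, trivial⟩ hn⟩)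
      have hcC : c ∉ C := fun h => hc ⟨c, h, .refl⟩
      rcases hbc.2 with ha | ha
      · by_cases hcX : c = X
        · exact .inl (.inl hcX)
        · exact .inl (.inr ⟨.bwd, .bwd, ha.trail_bwd hcX hc, trivial,
            fun h => False.elim h.1, fun _ => hcC⟩)
      · by_cases hcY : c = Y
        · subst hcY
          exact .inr ⟨k, _, t, hk, trivial⟩
        · exact .inr ⟨k, .fwd, t.append (k₂ := .fwd)
            ⟨fun h => False.elim h.2, fun _ => hcC⟩ (ha.trail hcY hc), hk, trivial⟩
    · exact .inr ih

/-- An inducing chain can take the place of a bi-directed edge in any open trail. -/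
theorem exists_trail_of_inducing {X Y : V} (hXY : X ≠ Y)
    (h : Relation.ReflTransGen (G.InducingStep X Y) X Y) (C : Set V) :
    ∃ k l, G.Trail C k X Y l ∧ k.HeadAtSource ∧ l.HeadAtTarget := by
  rcases Relation.ReflTransGen.cases_tail h with h | ⟨v, hv, hvY⟩
  · exact absurd h.symm hXY
  rcases exists_trail_of_inducing_prefix hv C with (rfl | ⟨k, l, t, hk, ho⟩) | h
  · exact ⟨.bidir, .bidir, .single hvY.1, trivial, trivial⟩
  · exact ⟨k, .bidir, t.append ho (.single hvY.1), hk, trivial⟩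
  · exact h

theorem Walk.OpenAfter.isAncestor {u w : V} {k : EdgeKind} {p : Walk G u w}
    (hp : p.OpenAfter C k) (hk : k.HeadAtTarget) :
    (∃ c ∈ C, G.IsAncestor u c) ∨ G.IsAncestor u w := by
  induction p generalizing k with
  | nil u => exact .inr .refl
  | cons k' h p ih =>
    cases k' with
    | fwd =>
      rcases ih hp.2 trivial with ⟨c, hc, ha⟩ | ha
      · exact .inl ⟨c, hc, .head h ha⟩
      · exact .inr (.head h ha)
    | bwd => exact .inl (hp.1.1 ⟨hk, trivial⟩)
    | bidir => exact .inl (hp.1.1 ⟨hk, trivial⟩)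

theorem DirAcyclic.not_isAncestor (hG : G.DirAcyclic) {u v : V} (h : G.dir u v) :
    ¬ G.IsAncestor v u := fun ha => hG u (Relation.TransGen.head' h ha)

theorem DirAcyclic.ne (hG : G.DirAcyclic) {u v : V} (h : G.dir u v) : u ≠ v := by
  rintro rfl
  exact hG _ (.single h)

/-- The ancestors of `X` and `Y` other than `X` and `Y`. -/
def properAncestors (G : MixedGraph V) (X Y : V) : Set V :=
  {v | (G.IsAncestor v X ∨ G.IsAncestor v Y) ∧ v ≠ X ∧ v ≠ Y}

/-- Open colliders are ancestors of the conditioning set, so every interior vertex is an ancestor of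
`X` or `Y`. It then belongs to the conditioning set and must itself be a collider, which leaves only
bi-directed edges between interior vertices. -/
theorem Walk.OpenAfter.inducing {X Y : V} (hG : G.DirAcyclic) (hYX : ¬ G.IsAncestor Y X)
    {u : V} {k : EdgeKind} {p : Walk G u Y} (hp : p.OpenAfter (G.properAncestors X Y) k)
    (hnd : p.support.Nodup) (hX : X ∉ p.support)
    (hk : k.HeadAtTarget ∨ G.IsAncestor u X ∨ G.IsAncestor u Y) :
    Relation.ReflTransGen (G.InducingStep X Y) u Y ∧ (G.IsAncestor u X ∨ G.IsAncestor u Y) ∧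
      (u ≠ Y → k.HeadAtTarget) := by
  induction p generalizing k with
  | nil u => exact ⟨.refl, .inr .refl, fun h => absurd rfl h⟩
  | @cons u x Y k' h p ih =>
    have hu : G.IsAncestor u X ∨ G.IsAncestor u Y := by
      rcases hk with hk | hk
      · rcases hp.isAncestor hk with ⟨c, hc, ha⟩ | ha
        · exact hc.1.imp ha.trans ha.trans
        · exact .inr ha
      · exact hk
    have hmem : ∀ {v w : V} (q : Walk G v w), w ∈ q.support := by
      intro v w q
      induction q with
      | nil => simp [Walk.support]
      | cons _ _ _ ih => exact List.mem_cons_of_mem _ ih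
    obtain ⟨hup, hnd'⟩ := List.nodup_cons.1 hnd
    have huY : u ≠ Y := fun e => hup (e ▸ hmem p)
    have hXu : X ≠ u := fun e => hX (e ▸ List.mem_cons_self)
    have hXp : X ∉ p.support := fun e => hX (List.mem_cons_of_mem _ e)
    have hcol : k.HeadAtTarget ∧ k'.HeadAtSource :=
      by_contra fun hn => hp.1.2 hn ⟨hu, hXu.symm, huY⟩
    have hk' : k'.HeadAtTarget ∨ G.IsAncestor x X ∨ G.IsAncestor x Y := by
      cases k' with
      | fwd => exact .inl trivial
      | bwd => exact .inr (hu.imp (.head h) (.head h))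
      | bidir => exact .inl trivial
    obtain ⟨h1, h2, h3⟩ := ih hYX hp.2 hnd' hXp hk'
    refine ⟨?_, hu, fun _ => hcol.1⟩
    cases k' with
    | fwd => exact hcol.2.elim
    | bwd =>
      by_cases hx : x = Y
      · subst hx
        rcases hu with hu | hu
        · exact absurd (.head h hu) hYX
        · exact absurd hu (hG.not_isAncestor h)
      · exact (h3 hx).elim
    | bidir => exact .head ⟨h, h2⟩ h1

theorem DConnected.inducing {X Y : V} (hG : G.DirAcyclic) (hne : X ≠ Y)
    (hXY : ¬ G.IsAncestor X Y) (hYX : ¬ G.IsAncestor Y X)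
    (h : G.DConnected (G.properAncestors X Y) X Y) :
    Relation.ReflTransGen (G.InducingStep X Y) X Y := by
  obtain ⟨p, hnd, hp⟩ := h
  cases p with
  | nil => exact absurd rfl hne
  | @cons _ x _ k e p =>
    obtain ⟨hXp, hnd'⟩ := List.nodup_cons.1 hnd
    have hk : k.HeadAtTarget ∨ G.IsAncestor x X ∨ G.IsAncestor x Y := by
      cases k with
      | fwd => exact .inl trivial
      | bwd => exact .inr (.inl (.single e))
      | bidir => exact .inl trivial
    obtain ⟨h1, h2, h3⟩ := Walk.OpenAfter.inducing hG hYX hp hnd' hXp hk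
    cases k with
    | fwd =>
      rcases h2 with h2 | h2
      · exact absurd h2 (hG.not_isAncestor e)
      · exact absurd (.head e h2) hXY
    | bwd =>
      by_cases hx : x = Y
      · subst hx
        exact absurd (.single e) hYX
      · exact (h3 hx).elim
    | bidir => exact .head ⟨e, h2⟩ h1

/-! ### Adding bi-directed edges -/

theorem addBi_bi_self {X Y : V} (h : X ≠ Y) : (G.addBi X Y).bi X Y := .inr ⟨h, rfl⟩

theorem addBi_bi_iff {X Y u v : V} :
    (G.addBi X Y).bi u v ↔ G.bi u v ∨ (u ≠ v ∧ (u = X ∧ v = Y ∨ u = Y ∧ v = X)) := by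
  simp [addBi]

theorem addBi_contains (G : MixedGraph V) (X Y : V) : (G.addBi X Y).Contains G :=
  ⟨fun _ _ h => h, fun _ _ h => .inl h⟩

theorem Contains.addBi {X Y : V} (h : H.Contains G) (hXY : H.bi X Y) :
    H.Contains (G.addBi X Y) := by
  refine ⟨h.1, fun u v huv => ?_⟩
  rcases addBi_bi_iff.1 huv with huv | ⟨_, ⟨rfl, rfl⟩ | ⟨rfl, rfl⟩⟩
  · exact h.2 _ _ huv
  · exact hXY
  · exact H.bi_symm _ _ hXY

theorem Contains.trans {K : MixedGraph V} (h : K.Contains H) (h' : H.Contains G) :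
    K.Contains G :=
  ⟨fun _ _ e => h.1 _ _ (h'.1 _ _ e), fun _ _ e => h.2 _ _ (h'.2 _ _ e)⟩

theorem Contains.refl (G : MixedGraph V) : G.Contains G := ⟨fun _ _ e => e, fun _ _ e => e⟩

theorem MarkovEquiv.symm (h : G.MarkovEquiv H) : H.MarkovEquiv G :=
  fun A B C h1 h2 h3 => (h A B C h1 h2 h3).symm

theorem MarkovEquiv.trans {K : MixedGraph V} (h : G.MarkovEquiv H) (h' : H.MarkovEquiv K) :
    G.MarkovEquiv K :=
  fun A B C h1 h2 h3 => (h A B C h1 h2 h3).trans (h' A B C h1 h2 h3)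

theorem MarkovEquiv.dConnected_iff (h : G.MarkovEquiv H) {X Y : V} (hne : X ≠ Y) (hX : X ∉ C)
    (hY : Y ∉ C) : G.DConnected C X Y ↔ H.DConnected C X Y := by
  have := h {X} {Y} C (by simpa using hne) (by simpa using hX) (by simpa using hY)
  simp only [DSep, Set.mem_singleton_iff, forall_eq] at this
  exact not_iff_not.1 this

theorem Adjacent.dConnected {X Y : V} (h : G.Adjacent X Y) (C : Set V) :
    G.DConnected C X Y := by
  rcases h with h | h | h
  · exact (Trail.single (k := .fwd) h).dConnected
  · exact (Trail.single (k := .bwd) h).dConnected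
  · exact (Trail.single (k := .bidir) h).dConnected

theorem IsMaximal.exists_not_dConnected (hL : L.IsMaximal) {X Y : V} (hne : X ≠ Y)
    (h : ¬ L.Adjacent X Y) : ∃ Z : Set V, X ∉ Z ∧ Y ∉ Z ∧ ¬ L.DConnected Z X Y := by
  obtain ⟨Z, hX, hY, hZ⟩ := hL X Y hne h
  exact ⟨Z, hX, hY, hZ X rfl Y rfl⟩

theorem MarkovEquiv.adjacent (h : G.MarkovEquiv L) (hL : L.IsMaximal) {X Y : V} (hne : X ≠ Y)
    (hG : G.Adjacent X Y) : L.Adjacent X Y := by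
  by_contra hn
  obtain ⟨Z, hX, hY, hZ⟩ := hL.exists_not_dConnected hne hn
  exact hZ ((h.dConnected_iff hne hX hY).1 (hG.dConnected Z))

/-- Adding a bi-directed edge over an inducing chain breaks no d-separation. -/
theorem markovEquiv_addBi_of_inducing {X Y : V} (hne : X ≠ Y)
    (h : Relation.ReflTransGen (G.InducingStep X Y) X Y)
    (h' : Relation.ReflTransGen (G.InducingStep Y X) Y X) : (G.addBi X Y).MarkovEquiv G := by
  intro A B C hAB _ _
  refine ⟨DSep.anti (G := G) (H := G.addBi X Y) rfl (addBi_contains G X Y).2 hAB, fun hs a ha b hb hc => ?_⟩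
  refine hs a ha b hb (hc.map (G := G.addBi X Y) (H := G) rfl (fun k u v e => ?_)
    (fun e => Set.disjoint_left.1 hAB ha (e ▸ hb)))
  cases k with
  | fwd => exact ⟨.fwd, .fwd, .single e, Iff.rfl, Iff.rfl⟩
  | bwd => exact ⟨.bwd, .bwd, .single e, Iff.rfl, Iff.rfl⟩
  | bidir =>
    rcases (addBi_bi_iff (G := G)).1 e with e | ⟨_, ⟨rfl, rfl⟩ | ⟨rfl, rfl⟩⟩
    · exact ⟨.bidir, .bidir, .single e, Iff.rfl, Iff.rfl⟩
    · obtain ⟨k, l, t, hk, hl⟩ := exists_trail_of_inducing hne h C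
      exact ⟨k, l, t, iff_of_true hk trivial, iff_of_true hl trivial⟩
    · obtain ⟨k, l, t, hk, hl⟩ := exists_trail_of_inducing hne.symm h' C
      exact ⟨k, l, t, iff_of_true hk trivial, iff_of_true hl trivial⟩

/-! ### Compatible diagrams -/

/-- By maximality an edge of `H` joins vertices adjacent in `L`; since ancestry agrees and `L` is
ancestral, that adjacency can only be the same directed edge. -/
theorem IsCompatibleWith.dir_eq (hL : L.IsMAG) (h : H.IsCompatibleWith L) : H.dir = L.dir := by
  funext X Y
  refine propext ⟨fun e => ?_, h.2 X Y⟩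
  have ha : L.IsAncestor X Y := (h.1.2.2 X Y).1 (.single e)
  rcases h.1.2.1.adjacent hL.2 (DirAcyclic.ne h.1.1 e) (.inl e) with h' | h' | h'
  · exact h'
  · exact absurd ha (hL.1.1.not_isAncestor h')
  · exact absurd ha (hL.1.2 _ _ h')

theorem isCompatibleWith_of_dir_eq (hL : L.IsMAG) (hd : H.dir = L.dir) (h : H.MarkovEquiv L) :
    H.IsCompatibleWith L := by
  refine ⟨⟨?_, h, fun X Y => ?_⟩, fun X Y e => hd ▸ e⟩
  · unfold IsCausalDiagram DirAcyclic
    rw [hd]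
    exact hL.1.1
  · unfold IsAncestor
    rw [hd]

theorem IsMAG.isCompatibleWith_self (hL : L.IsMAG) : L.IsCompatibleWith L :=
  isCompatibleWith_of_dir_eq hL rfl fun _ _ _ _ _ _ => Iff.rfl

/-- A diagram between `L` and a diagram compatible with `L` is compatible with `L`. -/
theorem IsCompatibleWith.of_contains (hL : L.IsMAG) (h : H.IsCompatibleWith L)
    (hHG : H.Contains G) (hGL : G.Contains L) : G.IsCompatibleWith L := by
  have hHd := h.dir_eq hL
  have hd : G.dir = L.dir := by
    funext X Y
    exact propext ⟨fun e => hHd ▸ hHG.1 X Y e, hGL.1 X Y⟩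
  refine isCompatibleWith_of_dir_eq hL hd fun A B C hAB hAC hBC => ⟨?_, fun hs => ?_⟩
  · exact DSep.anti hd.symm hGL.2 hAB
  · exact DSep.anti (hd.trans hHd.symm) hHG.2 hAB ((h.1.2.1 A B C hAB hAC hBC).2 hs)

/-- A maximally bi-directed compatible diagram has all the bi-directed edges of `L`. -/
theorem IsCompatibleWith.contains_of_isMBD (hL : L.IsMAG) (h : H.IsCompatibleWith L)
    (hM : H.IsMBD) : H.Contains L := by
  refine ⟨h.2, fun X Y hXY => ?_⟩
  -- The edge in `L` keeps `X` and `Y` d-connected given their proper ancestors, and Markov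
  -- equivalence carries this to `H`, where the connecting path is an inducing chain.
  have key : ∀ {X Y : V}, L.bi X Y → Relation.ReflTransGen (H.InducingStep X Y) X Y := by
    intro X Y hXY
    have hne : X ≠ Y := by
      rintro rfl
      exact L.bi_irrefl _ hXY
    refine DConnected.inducing h.1.1 hne (fun ha => hL.1.2 _ _ hXY ((h.1.2.2 _ _).1 ha))
      (fun ha => hL.1.2 _ _ (L.bi_symm _ _ hXY) ((h.1.2.2 _ _).1 ha)) ?_
    refine (h.1.2.1.dConnected_iff hne (fun hm => hm.2.1 rfl) (fun hm => hm.2.2 rfl)).2 ?_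
    exact Adjacent.dConnected (.inr (.inr hXY)) _
  by_contra hn
  have hne : X ≠ Y := by
    rintro rfl
    exact L.bi_irrefl _ hXY
  exact hM X Y hne hn (markovEquiv_addBi_of_inducing hne (key hXY) (key (L.bi_symm _ _ hXY)))

theorem IsInvisible.addBi_isCompatibleWith (hL : L.IsMAG) (hGL : G.Contains L) {X Y : V}
    (h : IsInvisible L G X Y) : (G.addBi X Y).IsCompatibleWith L := by
  obtain ⟨-, -, H, hH, hHG, hXY⟩ := h
  exact hH.of_contains hL (hHG.addBi hXY) ((addBi_contains G X Y).trans hGL)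

/-- Every invisible edge `X → Y` of `L` has its parents and spouses of `X` adjacent to `Y`. -/
theorem IsInvisible.parentsSpousesAdjacent (hL : L.IsMAG) {X Y : V}
    (h : IsInvisible L L X Y) : L.ParentsSpousesAdjacent X Y := by
  obtain ⟨hXY, -, H, hH, hHL, hbi⟩ := h
  intro Z hZY hZX
  by_contra hn
  obtain ⟨C, hZ, hY, hC⟩ := hL.2.exists_not_dConnected hZY hn
  obtain ⟨k, hkL, hkH, hk⟩ :
      ∃ k : EdgeKind, L.HasEdge k Z X ∧ H.HasEdge k Z X ∧ k.HeadAtTarget := by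
    rcases hZX with e | e
    · exact ⟨.fwd, e, hHL.1 _ _ e, trivial⟩
    · exact ⟨.bidir, e, hHL.2 _ _ e, trivial⟩
  -- In `L`, `X` is a non-collider between `Z` and `Y`, so the separating set contains it; in `H`
  -- the edge `X ↔ Y` makes `X` a collider opened by that same set.
  have hX : X ∈ C := by
    by_contra hX
    exact hC (Trail.cons hkL (k' := .fwd) ⟨fun h => False.elim h.2, fun _ => hX⟩
      (.single hXY)).dConnected
  refine hC ((hH.1.2.1.dConnected_iff hZY hZ hY).1 (Trail.cons hkH (k' := .bidir)
    ⟨fun _ => ⟨X, hX, .refl⟩, fun hn => absurd ⟨hk, trivial⟩ hn⟩ (.single hbi)).dConnected)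

/-- A bi-directed edge of a larger compatible diagram lies over an invisible edge. -/
theorem IsCompatibleWith.isInvisible_or (hL : L.IsMAG) (hGL : G.Contains L)
    (hH : H.IsCompatibleWith L) (hHG : H.Contains G) {X Y : V} (hXY : H.bi X Y)
    (hn : ¬ G.bi X Y) : IsInvisible L G X Y ∨ IsInvisible L G Y X := by
  have hne : X ≠ Y := by
    rintro rfl
    exact H.bi_irrefl _ hXY
  rcases hH.1.2.1.adjacent hL.2 hne (.inr (.inr hXY)) with e | e | e
  · exact .inl ⟨hGL.1 _ _ e, hn, H, hH, hHG, hXY⟩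
  · exact .inr ⟨hGL.1 _ _ e, fun h => hn (G.bi_symm _ _ h), H, hH, hHG, H.bi_symm _ _ hXY⟩
  · exact absurd (hGL.2 _ _ e) hn

theorem IsCompatibleWith.eq_of_not_hasInvisible (hL : L.IsMAG) (hGL : G.Contains L)
    (hH : H.IsCompatibleWith L) (hHG : H.Contains G) (hn : ¬ HasInvisible L G) : G = H := by
  have hd := hH.dir_eq hL
  ext X Y
  · exact ⟨hHG.1 X Y, fun e => hGL.1 X Y (hd ▸ e)⟩
  · refine ⟨hHG.2 X Y, fun e => by_contra fun hne => hn ?_⟩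
    rcases hH.isInvisible_or hL hGL hHG e hne with h | h
    · exact ⟨X, Y, h⟩
    · exact ⟨Y, X, h⟩

/-- A diagram with invisible edges can be extended inside a larger one that has none. -/
theorem IsCompatibleWith.exists_isInvisible_addBi (hL : L.IsMAG) (hGL : G.Contains L)
    (hH : H.IsCompatibleWith L) (hHG : H.Contains G) (hG : HasInvisible L G)
    (hn : ¬ HasInvisible L H) : ∃ X Y, IsInvisible L G X Y ∧ H.Contains (G.addBi X Y) := by
  by_contra! hcon
  have hbi : ∀ u v, H.bi u v → G.bi u v := by
    intro u v huv
    by_contra hne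
    rcases hH.isInvisible_or hL hGL hHG huv hne with h | h
    · exact hcon _ _ h (hHG.addBi huv)
    · exact hcon _ _ h (hHG.addBi (H.bi_symm _ _ huv))
  have hGH : G = H := by
    ext u v
    · exact ⟨hHG.1 u v, fun e => hGL.1 u v (hH.dir_eq hL ▸ e)⟩
    · exact ⟨hHG.2 u v, hbi u v⟩
  subst hGH
  exact hn hG

theorem IsCompatibleWith.isMBD_iff (hL : L.IsMAG) (hG : G.IsCompatibleWith L)
    (hGL : G.Contains L) : G.IsMBD ↔ ¬ HasInvisible L G := by
  constructor
  · rintro hM ⟨X, Y, h⟩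
    exact hM X Y (DirAcyclic.ne hG.1.1 h.1) h.2.1
      ((h.addBi_isCompatibleWith hL hGL).1.2.1.trans hG.1.2.1.symm)
  · intro hn X Y hne hb hE
    have hc : (G.addBi X Y).IsCompatibleWith L :=
      isCompatibleWith_of_dir_eq hL (hG.dir_eq (H := G) hL) (hE.trans hG.1.2.1)
    rcases hc.isInvisible_or hL hGL (addBi_contains G X Y) (addBi_bi_self hne) hb with h | h
    · exact hn ⟨X, Y, h⟩
    · exact hn ⟨Y, X, h⟩

/-! ### The procedure -/

theorem mem_children [Fintype V] {K : MixedGraph V} :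
    K ∈ children L G ↔ ∃ X Y, IsInvisible L G X Y ∧ K = G.addBi X Y := by
  simp [children, invisibleEdges, eq_comm]

theorem mem_unfinished {K : MixedGraph V} {l : List (MixedGraph V)} :
    K ∈ unfinished L l ↔ K ∈ l ∧ HasInvisible L K := by
  simp [unfinished]

theorem mem_finished {K : MixedGraph V} {l : List (MixedGraph V)} :
    K ∈ finished L l ↔ K ∈ l ∧ ¬ HasInvisible L K := by
  simp [finished]

theorem mem_initialDiagrams [Fintype V] {K : MixedGraph V} (h : HasInvisible L L) (hL : L.IsMAG) :
    K ∈ initialDiagrams L ↔ ∃ X Y, IsInvisible L L X Y ∧ K = L.addBi X Y := by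
  have : ∀ X Y, IsInvisible L L X Y ∧ L.ParentsSpousesAdjacent X Y ↔ IsInvisible L L X Y :=
    fun X Y => and_iff_left_of_imp fun h => h.parentsSpousesAdjacent hL
  simp [initialDiagrams, invisibleEdges, h, this, eq_comm]

/-- The invariant of the procedure after `n` passes. -/
structure Invariant (L : MixedGraph V) (n : ℕ) (s : List (MixedGraph V) × List (MixedGraph V)) :
    Prop where
  sound : ∀ K ∈ s.1, K.Contains L
  growing : ∀ K ∈ s.1, n ≤ Set.ncard {e : V × V | K.bi e.1 e.2}
  returned : ∀ K ∈ s.2, K.IsCompatibleWith L ∧ K.Contains L ∧ ¬ HasInvisible L K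
  unfinished : ∀ K ∈ s.1, HasInvisible L K
  complete : ∀ K : MixedGraph V, K.IsCompatibleWith L → K.Contains L → ¬ HasInvisible L K →
    K ∈ s.2 ∨ ∃ G ∈ s.1, K.Contains G

theorem invariant_initialState [Fintype V] (hL : L.IsMAG) : Invariant L 0 (initialState L) := by
  by_cases h : HasInvisible L L
  · refine ⟨fun K hK => ?_, fun K _ => Nat.zero_le _, fun K hK => ?_, fun K hK => ?_,
      fun K hK hKL hn => ?_⟩
    · obtain ⟨X, Y, hXY, rfl⟩ := (mem_initialDiagrams h hL).1 (mem_unfinished.1 hK).1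
      exact addBi_contains L X Y
    · obtain ⟨hK, hn⟩ := mem_finished.1 hK
      obtain ⟨X, Y, hXY, rfl⟩ := (mem_initialDiagrams h hL).1 hK
      exact ⟨hXY.addBi_isCompatibleWith hL (.refl L), addBi_contains L X Y, hn⟩
    · exact (mem_unfinished.1 hK).2
    · obtain ⟨X, Y, hXY, hc⟩ := hK.exists_isInvisible_addBi hL (.refl L) hKL h hn
      have hm := (mem_initialDiagrams h hL).2 ⟨X, Y, hXY, rfl⟩
      by_cases hi : HasInvisible L (L.addBi X Y)
      · exact .inr ⟨_, mem_unfinished.2 ⟨hm, hi⟩, hc⟩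
      · rw [← hK.eq_of_not_hasInvisible hL (addBi_contains L X Y) hc hi]
        exact .inl (mem_finished.2 ⟨hm, hi⟩)
  · have h1 : (initialState L).1 = [] := by simp [initialState, initialDiagrams, h, unfinished]
    have h2 : (initialState L).2 = [L] := by simp [initialState, initialDiagrams, h, finished]
    refine ⟨by simp [h1], by simp [h1], ?_, by simp [h1], fun K hK hKL hn => .inl ?_⟩
    · simpa [h2] using ⟨hL.isCompatibleWith_self, Contains.refl L, h⟩
    · rw [← hK.eq_of_not_hasInvisible hL (.refl L) hKL h, h2]
      exact List.mem_singleton_self L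

theorem Invariant.pass [Fintype V] (hL : L.IsMAG) {n : ℕ}
    {s : List (MixedGraph V) × List (MixedGraph V)}
    (h : Invariant L n s) : Invariant L (n + 1) (pass L s) := by
  have hmem : ∀ {K}, K ∈ (MixedGraph.pass L s).1 ↔
      ∃ G ∈ s.1, (∃ X Y, IsInvisible L G X Y ∧ K = G.addBi X Y) ∧ HasInvisible L K := by
    intro K
    simp only [MixedGraph.pass, List.mem_flatMap, mem_unfinished, mem_children]
  have hmem' : ∀ {K}, K ∈ (MixedGraph.pass L s).2 ↔ K ∈ s.2 ∨
      ∃ G ∈ s.1, (∃ X Y, IsInvisible L G X Y ∧ K = G.addBi X Y) ∧ ¬ HasInvisible L K := by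
    intro K
    simp only [MixedGraph.pass, List.mem_append, List.mem_flatMap, mem_finished, mem_children]
  refine ⟨fun K hK => ?_, fun K hK => ?_, fun K hK => ?_, fun K hK => ?_, fun K hK hKL hn => ?_⟩
  · obtain ⟨G, hG, ⟨X, Y, -, rfl⟩, -⟩ := hmem.1 hK
    exact (addBi_contains G X Y).trans (h.sound G hG)
  · obtain ⟨G, hG, ⟨X, Y, hXY, rfl⟩, -⟩ := hmem.1 hK
    have hne : X ≠ Y := by
      rintro rfl
      obtain ⟨-, -, H, -, -, hb⟩ := hXY
      exact H.bi_irrefl _ hb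
    -- The added edge is new, so the inclusion of edge sets is strict.
    refine (h.growing G hG).trans_lt (Set.ncard_lt_ncard ⟨fun e he => .inl he, fun hs => ?_⟩)
    exact hXY.2.1 (@hs (X, Y) (addBi_bi_self hne))
  · rcases hmem'.1 hK with hK | ⟨G, hG, ⟨X, Y, hXY, rfl⟩, hn⟩
    · exact h.returned K hK
    · exact ⟨hXY.addBi_isCompatibleWith hL (h.sound G hG),
        (addBi_contains G X Y).trans (h.sound G hG), hn⟩
  · obtain ⟨_, _, _, hi⟩ := hmem.1 hK
    exact hi
  · rcases h.complete K hK hKL hn with hK' | ⟨G, hG, hKG⟩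
    · exact .inl (hmem'.2 (.inl hK'))
    · obtain ⟨X, Y, hXY, hc⟩ :=
        hK.exists_isInvisible_addBi hL (h.sound G hG) hKG (h.unfinished G hG) hn
      by_cases hi : HasInvisible L (G.addBi X Y)
      · exact .inr ⟨_, hmem.2 ⟨G, hG, ⟨X, Y, hXY, rfl⟩, hi⟩, hc⟩
      -- A child inside `K` without invisible edges leaves no room for further edges, so it is `K`.
      · have he := hK.eq_of_not_hasInvisible hL
          ((addBi_contains G X Y).trans (h.sound G hG)) hc hi
        exact .inl (hmem'.2 (.inr ⟨G, hG, ⟨X, Y, hXY, he.symm⟩, hn⟩))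

theorem invariant_iterate [Fintype V] (hL : L.IsMAG) (n : ℕ) :
    Invariant L n ((pass L)^[n] (initialState L)) := by
  induction n with
  | zero => exact invariant_initialState hL
  | succ n ih =>
    rw [Function.iterate_succ_apply']
    exact ih.pass hL

end MixedGraph

theorem mainTheorem10 {V : Type*} [Fintype V] (L : MixedGraph V) (hL : L.IsLEG) :
    ∃ out : List (MixedGraph V), MixedGraph.Returns L out ∧
      ∀ G : MixedGraph V, G ∈ out ↔ (G.IsCompatibleWith L ∧ G.IsMBD) := by
  obtain ⟨_, _, hM, _⟩ := hL
  -- A diagram still in `S` after `n` passes has at least `n` ordered bi-directed pairs, one more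
  -- than there are pairs at all.
  set n := Nat.card (V × V) + 1 with hn
  have h := MixedGraph.invariant_iterate hM n
  have hnil : ((MixedGraph.pass L)^[n] (MixedGraph.initialState L)).1 = [] := by
    refine List.eq_nil_iff_forall_not_mem.2 fun K hK => ?_
    have h1 := h.growing K hK
    have h2 := Set.ncard_le_card {e : V × V | K.bi e.1 e.2}
    omega
  refine ⟨_, ⟨n, Prod.ext hnil rfl⟩, fun G => ⟨fun hG => ?_, fun ⟨hG, hMBD⟩ => ?_⟩⟩
  · obtain ⟨h1, h2, h3⟩ := h.returned G hG
    exact ⟨h1, (h1.isMBD_iff hM h2).2 h3⟩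
  · have hGL := hG.contains_of_isMBD hM hMBD
    rcases h.complete G hG hGL ((hG.isMBD_iff hM hGL).1 hMBD) with h' | ⟨K, hK, -⟩
    · exact h'
    · rw [hnil] at hK
      exact absurd hK List.not_mem_nil
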